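/- Let $G$ be a finite simple connected split graph, i.e. $V(G)$ is the disjoint union of a clique and an independent set. Let $\sigma(G)$, the stretch index of $G$, be the smallest $t$ such that $G$ has a spanning tree in which any two vertices that are adjacent in $G$ are at distance at most $t$. Let $\Delta(G)$ be the maximum degree of $G$. Call $G$ Class 1 if its edges can be properly colored with $\Delta(G)$ colors (distinct edges with a common end receive distinct colors), call a graph $H$ overfull if $|E(H)|>\Delta(H)\cdot\lfloor |V(H)|/2\rfloor$, and call $G$ subgraph-overfull if it has an overfull (not necessarily induced) subgraph $H$ with $\Delta(H)=\Delta(G)$. If $\sigma(G)=2$ and $\Delta(G)>|V(G)|/3$, then $G$ is Class 1 if and only if $G$ is not subgraph-overfull. That is, split graphs with stretch index $2$ satisfy Hilton's Overfull Conjecture. -/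

import Mathlib

namespace SimpleGraph

variable {V : Type*}

/-- `G` is a split graph: its vertex set is the disjoint union of a clique and an
independent set. -/
def IsSplit (G : SimpleGraph V) : Prop :=
  ∃ X : Set V, G.IsClique X ∧ G.IsIndepSet Xᶜ

/-- `T` is a tree `t`-spanner of `G`: a spanning tree of `G` in which any two vertices that are
adjacent in `G` have distance at most `t`. -/
def IsTreeSpanner (G T : SimpleGraph V) (t : ℕ) : Prop :=
  T ≤ G ∧ T.IsTree ∧ ∀ u v : V, G.Adj u v → T.dist u v ≤ t

/-- `G` is `t`-admissible: it has a tree `t`-spanner. -/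
def IsAdmissible (G : SimpleGraph V) (t : ℕ) : Prop :=
  ∃ T : SimpleGraph V, G.IsTreeSpanner T t

/-- The stretch index `σ(G)`: the least `t` such that `G` is `t`-admissible. (A finite connected
graph is `t`-admissible for some `t`.) -/
noncomputable def stretchIndex (G : SimpleGraph V) : ℕ :=
  sInf {t : ℕ | G.IsAdmissible t}

/-- `G` is `k`-edge-colorable: its edges can be given `k` colors such that distinct edges with a
common end receive distinct colors. -/
def EdgeColorable (G : SimpleGraph V) (k : ℕ) : Prop :=
  G.lineGraph.Colorable k

/-- `G` is Class 1: it is `Δ(G)`-edge-colorable. -/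
def IsClassOne [Fintype V] (G : SimpleGraph V) [DecidableRel G.Adj] : Prop :=
  G.EdgeColorable G.maxDegree

/-- `G` is overfull: `|E(G)| > Δ(G) * ⌊|V(G)| / 2⌋` (with `/` the integer division). -/
def IsOverfull [Fintype V] [DecidableEq V] (G : SimpleGraph V) [DecidableRel G.Adj] : Prop :=
  G.maxDegree * (Fintype.card V / 2) < G.edgeFinset.card

open scoped Classical in
/-- `G` is subgraph-overfull: it has an overfull subgraph `H` with `Δ(H) = Δ(G)`. -/
def IsSubgraphOverfull [Fintype V] (G : SimpleGraph V) : Prop :=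
  ∃ H : G.Subgraph, H.coe.maxDegree = G.maxDegree ∧ H.coe.IsOverfull

end SimpleGraph

/-! ### Tree 2-spanners of split graphs -/

namespace SimpleGraph

variable {V : Type*}

/-! Vertices of a clique are at pairwise distance at most two in a tree 2-spanner, so the clique
lies in a star with some centre `u`; splitness then makes `u` adjacent to every other vertex of
degree at least two. The vertices not adjacent to `u` have degree at most one, and their edges can
be coloured greedily at the end (`edgeColorable_of_induce`). What matters is the graph on the closed
neighbourhood of `u`, which has deg u + 1 vertices.

If deg u < Δ, even the complete graph there is Δ-colourable, by addition modulo its order. If deg u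
= Δ and Δ + 1 is even, the complete graph still suffices. If Δ + 1 = 2m + 1, the failure of
overfullness gives at least m non-edges, and splitness lets m of them be chosen within m + 1
vertices (`IsSplit.exists_edges_support`). The complete graph minus these m edges is then
2m-coloured (`exists_isProperOn_compl`): prescribe at each vertex as many missing colours as it has
removed edges, colour greedily inside the m + 1 vertices, and add the other vertices one at a time
by Hall's theorem (`IsProperOn.exists_extension`).

Conversely, colour classes are matchings, so an overfull subgraph of maximum degree Δ needs more
than Δ colours. -/

theorem exists_common_of_dist_le_two {T : SimpleGraph V} (hT : T.Connected) {x y : V}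
    (h : T.dist x y ≤ 2) : x = y ∨ T.Adj x y ∨ ∃ z, T.Adj x z ∧ T.Adj z y := by
  obtain ⟨p, hp⟩ := hT.exists_walk_length_eq_dist x y
  rw [← hp] at h
  match p, h with
  | .nil, _ => exact Or.inl rfl
  | .cons h1 .nil, _ => exact Or.inr (Or.inl h1)
  | .cons h1 (.cons h2 .nil), _ => exact Or.inr (Or.inr ⟨_, h1, h2⟩)
  | .cons h1 (.cons h2 (.cons h3 p)), h => simp at h

theorem IsAcyclic.false_of_paths {T : SimpleGraph V} (hT : T.IsAcyclic) {x y : V}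
    {p q : T.Walk x y} (hp : p.IsPath) (hq : q.IsPath) (h : p.support ≠ q.support) : False := by
  have := congrArg Subtype.val ((hT.subsingleton_path x y).elim ⟨p, hp⟩ ⟨q, hq⟩)
  simp only at this
  exact h (by rw [this])

theorem IsAcyclic.not_triangle {T : SimpleGraph V} (hT : T.IsAcyclic) {x y z : V}
    (h1 : T.Adj x y) (h2 : T.Adj y z) (h3 : T.Adj x z) : False := by
  refine hT.false_of_paths (p := .cons h1 (.cons h2 .nil)) (q := .cons h3 .nil) ?_ ?_ ?_ <;>
    simp [h1.ne, h2.ne, h3.ne]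

theorem IsAcyclic.eq_of_common {T : SimpleGraph V} (hT : T.IsAcyclic) {x y z w : V}
    (hxy : x ≠ y) (h1 : T.Adj x z) (h2 : T.Adj z y) (h3 : T.Adj x w) (h4 : T.Adj w y) :
    z = w := by
  by_contra hzw
  refine hT.false_of_paths (p := .cons h1 (.cons h2 .nil)) (q := .cons h3 (.cons h4 .nil))
    ?_ ?_ ?_ <;> simp [h1.ne, h2.ne, h3.ne, h4.ne, hxy, hzw]

/-- Vertices at pairwise distance at most two in a tree lie in the closed neighbourhood of one
vertex. -/
theorem IsTree.exists_center [Nonempty V] {T : SimpleGraph V} (hT : T.IsTree) {X : Set V}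
    (h : ∀ x ∈ X, ∀ y ∈ X, T.dist x y ≤ 2) : ∃ u, ∀ x ∈ X, x = u ∨ T.Adj u x := by
  have hA := hT.isAcyclic
  have h2 : ∀ x ∈ X, ∀ y ∈ X, x = y ∨ T.Adj x y ∨ ∃ z, T.Adj x z ∧ T.Adj z y :=
    fun x hx y hy => exists_common_of_dist_le_two hT.connected (h x hx y hy)
  rcases X.eq_empty_or_nonempty with rfl | ⟨x₀, h0⟩
  · exact ⟨Classical.arbitrary V, by simp⟩
  by_cases hall : ∀ x ∈ X, x = x₀ ∨ T.Adj x₀ x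
  · exact ⟨x₀, hall⟩
  push Not at hall
  obtain ⟨x₁, h1, hne, hnadj⟩ := hall
  obtain ⟨z, hz0, hz1⟩ : ∃ z, T.Adj x₀ z ∧ T.Adj z x₁ := by
    rcases h2 x₀ h0 x₁ h1 with h | h | h
    · exact absurd h.symm hne
    · exact absurd h hnadj
    · exact h
  refine ⟨z, fun y hy => ?_⟩
  by_contra hcon
  push Not at hcon
  obtain ⟨hyz, hzy⟩ := hcon
  have hy0 : y ≠ x₀ := fun h => hzy (h ▸ hz0.symm)
  have hy1 : y ≠ x₁ := fun h => hzy (h ▸ hz1)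
  -- If `y` is adjacent to one end of the path `a z b`, its short path to the other end avoids `z`,
  -- and the tree has two paths.
  have aux : ∀ a b : V, a ≠ b → ¬ T.Adj a b → T.Adj a z → T.Adj z b → y ≠ a → y ≠ b →
      T.Adj a y → (T.Adj y b ∨ ∃ q, T.Adj y q ∧ T.Adj q b) → False := by
    rintro a b hab hnab haz hzb hya hyb hay (hyb' | ⟨q, hyq, hqb⟩)
    · exact hyz (hA.eq_of_common hab haz hzb hay hyb').symm
    · have hqz : q ≠ z := fun h => hzy (h ▸ hyq.symm)
      have hqa : q ≠ a := fun h => hnab (h ▸ hqb)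
      refine hA.false_of_paths (x := y) (y := b) (p := .cons hay.symm (.cons haz (.cons hzb .nil)))
        (q := .cons hyq (.cons hqb .nil)) ?_ ?_ ?_ <;>
        simp [hya, hyz, hyb, haz.ne, hab, hzb.ne, hyq.ne, hqb.ne]
  rcases h2 x₀ h0 y hy with h | h | ⟨p, hp0, hpy⟩
  · exact hy0 h.symm
  · exact aux x₀ x₁ hne.symm hnadj hz0 hz1 hy0 hy1 h ((h2 y hy x₁ h1).resolve_left hy1)
  rcases h2 x₁ h1 y hy with h | h | ⟨q, hq1, hqy⟩
  · exact hy1 h.symm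
  · exact aux x₁ x₀ hne (fun h => hnadj h.symm) hz1.symm hz0.symm hy1 hy0 h
      ((h2 y hy x₀ h0).resolve_left hy0)
  have hpz : p ≠ z := fun h => hzy (h ▸ hpy)
  have hqz : q ≠ z := fun h => hzy (h ▸ hqy)
  by_cases hpq : p = q
  · subst hpq
    exact hpz (hA.eq_of_common hne.symm hp0 hq1.symm hz0 hz1)
  have hp1 : p ≠ x₁ := fun h => hnadj (h ▸ hp0)
  have hq0 : q ≠ x₀ := fun h => hnadj (h ▸ hq1.symm)
  refine hA.false_of_paths (x := x₀) (y := y)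
    (p := .cons hz0 (.cons hz1 (.cons hq1 (.cons hqy .nil))))
    (q := .cons hp0 (.cons hpy .nil)) ?_ ?_ ?_ <;>
    simp [hz0.ne, hne.symm, hq0.symm, hy0.symm, hz1.ne, hqz.symm, Ne.symm hyz, hq1.ne, hy1.symm,
      hqy.ne, hp0.ne, hpy.ne]

/-- A split graph with a tree `2`-spanner has a vertex adjacent to all vertices of degree at
least two. -/
theorem IsTreeSpanner.exists_adj_of_isSplit [Nonempty V] {G T : SimpleGraph V}
    (hsplit : G.IsSplit) (hT : G.IsTreeSpanner T 2) :
    ∃ u, ∀ v, v = u ∨ G.Adj u v ∨ (G.neighborSet v).Subsingleton := by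
  obtain ⟨hle, htree, hdist⟩ := hT
  have hA := htree.isAcyclic
  obtain ⟨X, u, hXc, hXi, hu⟩ : ∃ (X : Set V) (u : V), G.IsClique X ∧ G.IsIndepSet Xᶜ ∧
      ∀ x ∈ X, x = u ∨ T.Adj u x := by
    obtain ⟨X, hXc, hXi⟩ := hsplit
    obtain ⟨u, hu⟩ := htree.exists_center (X := X) (fun x hx y hy => by
      rcases eq_or_ne x y with rfl | hxy
      · simp
      · exact hdist x y (hXc hx hy hxy))
    exact ⟨X, u, hXc, hXi, hu⟩
  refine ⟨u, fun v => ?_⟩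
  by_contra hcon
  push Not at hcon
  obtain ⟨hvu, hnadj, hns⟩ := hcon
  have hvX : v ∉ X := fun hv => by
    rcases hu v hv with h | h
    · exact hvu h
    · exact hnadj (hle h)
  have hnb : ∀ x, G.Adj v x → x ∈ X ∧ T.Adj u x := fun x hx => by
    have hxX : x ∈ X := by
      by_contra hxX
      exact hXi hvX hxX hx.ne hx
    rcases hu x hxX with rfl | h
    · exact absurd hx.symm hnadj
    · exact ⟨hxX, h⟩
  -- A detour `v z x` in the tree would put both `z` and `x` next to `u`, closing a triangle. So all
  -- edges at `v` are in `T`, and two of them would give a 4-cycle through `u`.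
  have hTadj : ∀ x, G.Adj v x → T.Adj v x := fun x hx => by
    rcases exists_common_of_dist_le_two htree.connected (hdist v x hx) with h | h | ⟨z, hz, hzx⟩
    · exact absurd h hx.ne
    · exact h
    · exact (hA.not_triangle (hnb z (hle hz)).2 hzx (hnb x hx).2).elim
  obtain ⟨x, hx, y, hy, hxy⟩ := hns
  exact hxy (hA.eq_of_common hvu (hTadj x hx) (hnb x hx).2.symm (hTadj y hy) (hnb y hy).2.symm)

end SimpleGraph

/-! ### Extending an edge colouring vertex by vertex -/

namespace SimpleGraph

variable {V C : Type*}

/-- `f` is a proper colouring of the edges of `G` with both ends in `W`. -/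
def IsProperOn (G : SimpleGraph V) (f : V → V → C) (W : Finset V) : Prop :=
  (∀ x y, f x y = f y x) ∧
    ∀ x ∈ W, ∀ y ∈ W, ∀ z ∈ W, G.Adj x y → G.Adj x z → f x y = f x z → y = z

/-- A bipartite graph in which every vertex of `W` has degree `r`, and every colour degree at most
`r`, has a matching that covers `W` and all colours of degree `r`. -/
theorem exists_matching_cover [DecidableEq V] [Fintype C] [DecidableEq C] [Nonempty C]
    (W U : Finset V) (r : ℕ) (hr : 0 < r)
    (hdisj : Disjoint W U) (hcard : Fintype.card C = W.card + U.card)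
    (Q : V → Finset C) (hQ : ∀ w ∈ W, (Q w).card = r)
    (hle : ∀ c, (W.filter (c ∈ Q ·)).card ≤ r) :
    ∃ P : V → C, Set.InjOn P W ∧ (∀ w ∈ W, P w ∈ Q w) ∧
      ∀ c, (W.filter (c ∈ Q ·)).card = r → ∃ w ∈ W, P w = c := by
  classical
  -- The vertices of `U` serve as dummies that balance the two sides and accept only colours of
  -- degree other than `r`; a perfect matching must then give every full colour to `W`.
  let D : Finset C := Finset.univ.filter fun c => (W.filter (c ∈ Q ·)).card ≠ r
  let t : {v // v ∈ W ∪ U} → Finset C := fun v => if v.1 ∈ W then Q v.1 else D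
  have hall : ∀ s : Finset {v // v ∈ W ∪ U}, s.card ≤ (s.biUnion t).card := by
    intro s
    let s' : Finset V := s.map (Function.Embedding.subtype _)
    have hs' : s'.card = s.card := Finset.card_map _
    have hsub : s' ⊆ W ∪ U := fun v hv => by
      obtain ⟨a, -, rfl⟩ := Finset.mem_map.1 hv
      exact a.2
    let A := s' ∩ W
    have hAQ : ∀ w ∈ A, Q w ⊆ s.biUnion t := fun w hw => by
      obtain ⟨h1, h2⟩ := Finset.mem_inter.1 hw
      obtain ⟨a, ha, rfl⟩ := Finset.mem_map.1 h1
      have : t a = Q a.1 := if_pos h2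
      rw [Function.Embedding.coe_subtype, ← this]
      exact Finset.subset_biUnion_of_mem t ha
    by_cases hne : s' ⊆ W
    · have hA : A = s' := Finset.inter_eq_left.2 hne
      rw [← hs', ← hA]
      have := Finset.card_mul_le_card_mul (s := A) (t := s.biUnion t) (m := r) (n := r)
        (fun w c => c ∈ Q w)
        (fun w hw => by
          rw [← hQ w (Finset.mem_inter.1 hw).2]
          refine Finset.card_le_card fun c hc => ?_
          simp only [Finset.bipartiteAbove, Finset.mem_filter]
          exact ⟨hAQ w hw hc, hc⟩)
        (fun c _ => (Finset.card_le_card (by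
          simp only [Finset.bipartiteBelow]
          exact Finset.filter_subset_filter _ Finset.inter_subset_right)).trans (hle c))
      exact Nat.le_of_mul_le_mul_right this hr
    · obtain ⟨v, hv, hvW⟩ := Finset.not_subset.1 hne
      obtain ⟨a, ha, rfl⟩ := Finset.mem_map.1 hv
      have hD : D ⊆ s.biUnion t := by
        have : t a = D := if_neg hvW
        rw [← this]
        exact Finset.subset_biUnion_of_mem t ha
      -- A colour outside the neighbourhood has degree `r`, all of it in `W \ A`; hence there are at
      -- most `(W \ A).card` such colours.
      have := Finset.card_mul_le_card_mul (s := (s.biUnion t)ᶜ) (t := W \ A) (m := r) (n := r)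
        (fun c w => c ∈ Q w)
        (fun c hc => by
          rw [Finset.mem_compl] at hc
          have hcr : (W.filter (c ∈ Q ·)).card = r := by
            by_contra h
            exact hc (hD (Finset.mem_filter.2 ⟨Finset.mem_univ _, h⟩))
          rw [← hcr]
          refine Finset.card_le_card fun w hw => ?_
          rw [Finset.mem_filter] at hw
          simp only [Finset.bipartiteAbove, Finset.mem_filter, Finset.mem_sdiff]
          exact ⟨⟨hw.1, fun hwA => hc (hAQ w hwA hw.2)⟩, hw.2⟩)
        (fun w hw => by
          rw [← hQ w (Finset.mem_sdiff.1 hw).1]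
          refine Finset.card_le_card fun c hc => ?_
          simp only [Finset.bipartiteBelow, Finset.mem_filter] at hc
          exact hc.2)
      have h1 := Nat.le_of_mul_le_mul_right this hr
      have h0 : (W \ A).card = W.card - A.card :=
        Finset.card_sdiff_of_subset Finset.inter_subset_right
      rw [Finset.card_compl, h0] at h1
      have h5 : (s' ∩ W).card = A.card := rfl
      have h2 : s'.card ≤ A.card + U.card := by
        rw [← Finset.card_inter_add_card_sdiff s' W]
        refine Nat.add_le_add_left (Finset.card_le_card fun v hv => ?_) _
        rw [Finset.mem_sdiff] at hv
        exact (Finset.mem_union.1 (hsub hv.1)).resolve_left hv.2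
      have h3 : A.card ≤ W.card := Finset.card_le_card Finset.inter_subset_right
      have h4 : (s.biUnion t).card ≤ Fintype.card C := Finset.card_le_univ _
      omega
  obtain ⟨p, hpi, hp⟩ := (Finset.all_card_le_biUnion_card_iff_exists_injective t).1 hall
  have hbij : Function.Bijective p := by
    rw [Fintype.bijective_iff_injective_and_card]
    refine ⟨hpi, ?_⟩
    rw [hcard, Fintype.card_coe, Finset.card_union_of_disjoint hdisj]
  refine ⟨fun v => if h : v ∈ W ∪ U then p ⟨v, h⟩ else Classical.arbitrary C, ?_, ?_, ?_⟩
  · intro x hx y hy hxy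
    have hx' : x ∈ W ∪ U := Finset.mem_union_left _ hx
    have hy' : y ∈ W ∪ U := Finset.mem_union_left _ hy
    simp only [hx', hy', dif_pos] at hxy
    simpa using hpi hxy
  · intro w hw
    have hw' : w ∈ W ∪ U := Finset.mem_union_left _ hw
    have := hp ⟨w, hw'⟩
    simp only [t, hw, if_true] at this
    simpa only [hw', dif_pos] using this
  · intro c hc
    obtain ⟨⟨v, hv⟩, rfl⟩ := hbij.2 c
    have hvW : v ∈ W := by
      by_contra h
      have := hp ⟨v, hv⟩
      simp only [t, h, if_false, D, Finset.mem_filter] at this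
      exact this.2 hc
    exact ⟨v, hvW, by simp only [hv, dif_pos]⟩

/-- Adding the vertices outside `W` one at a time to a coloured graph on `W`: `Q w` are the colours
that `w ∈ W` uses on its edges to the `r` vertices outside `W`. -/
theorem IsProperOn.exists_extension [Fintype V] [DecidableEq V] [Fintype C] [DecidableEq C]
    [Nonempty C] (G : SimpleGraph V) (hcard : Fintype.card C + 1 = Fintype.card V) (r : ℕ) :
    ∀ (W : Finset V) (f : V → V → C) (Q : V → Finset C), W.card + r = Fintype.card V →
      G.IsProperOn f W →
      (∀ w ∈ W, ∀ x ∈ W, G.Adj w x → f w x ∉ Q w) →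
      (∀ w ∈ W, (Q w).card = r) →
      (∀ c, (W.filter (c ∈ Q ·)).card ≤ r) →
      (∀ c, (W.filter (c ∈ Q ·)).card % 2 = r % 2) →
      ∃ f : V → V → C, G.IsProperOn f Finset.univ := by
  -- For each colour, the vertices of `W` that still need it require distinct partners outside, and
  -- the outside vertices left over are to be paired among themselves: hence the bound and the
  -- parity condition.
  induction r with
  | zero =>
    intro W f Q hW hf _ _ _ _
    rw [(Finset.card_eq_iff_eq_univ W).1 (by simpa using hW)] at hf
    exact ⟨f, hf⟩
  | succ r ih =>
    intro W f Q hW hf hfQ hQ hle hpar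
    obtain ⟨u, hu⟩ : ∃ u, u ∉ W := by
      by_contra! h
      have := (Finset.card_eq_iff_eq_univ W).2 (Finset.eq_univ_iff_forall.2 h)
      omega
    have hUcard : (Wᶜ.erase u).card = r := by
      rw [Finset.card_erase_of_mem (Finset.mem_compl.2 hu), Finset.card_compl]
      omega
    obtain ⟨P, hPi, hPQ, hPc⟩ := exists_matching_cover W (Wᶜ.erase u) (r + 1) r.succ_pos
      (disjoint_compl_right.mono_right (Finset.erase_subset _ _)) (by omega) Q hQ hle
    have hne : ∀ w ∈ W, w ≠ u := fun w hw h => hu (h ▸ hw)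
    let f' : V → V → C := fun x y => if x = u then P y else if y = u then P x else f x y
    -- The edge from `u` to `w` gets colour `P w`. The colours not matched to `W` number exactly
    -- `r`, and `u` keeps them for its edges to the remaining vertices.
    let Q' : V → Finset C := fun x => if x = u then Finset.univ \ W.image P else (Q x).erase (P x)
    have hfu : ∀ y, f' u y = P y := fun y => if_pos rfl
    have hfw : ∀ x ∈ W, f' x u = P x := fun x hx => by simp [f', hne x hx]
    have hff : ∀ x ∈ W, ∀ y ∈ W, f' x y = f x y := fun x hx y hy => by
      simp [f', hne x hx, hne y hy]
    have hQu : Q' u = Finset.univ \ W.image P := if_pos rfl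
    have hQw : ∀ x ∈ W, Q' x = (Q x).erase (P x) := fun x hx => if_neg (hne x hx)
    -- A matched colour loses its partner in `W`, an unmatched one gains `u`; either way the parity
    -- flips, as that of `r` does.
    have hcount : ∀ c, ((insert u W).filter (c ∈ Q' ·)).card + (if c ∈ W.image P then 1 else 0) =
        (W.filter (c ∈ Q ·)).card + (if c ∈ W.image P then 0 else 1) := by
      intro c
      have h1 : W.filter (c ∈ Q' ·) = (W.filter (c ∈ Q ·)).filter (P · ≠ c) := by
        rw [Finset.filter_filter]
        refine Finset.filter_congr fun w hw => ?_
        rw [hQw w hw, Finset.mem_erase, and_comm, ne_comm]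
      rw [Finset.filter_insert, hQu]
      split_ifs with h2 h3 h3
      · simp [h3] at h2
      · rw [Finset.card_insert_of_notMem (by simp [hu]), h1, Finset.filter_true_of_mem]
        intro w hw h
        exact h3 (Finset.mem_image.2 ⟨w, (Finset.mem_filter.1 hw).1, h⟩)
      · obtain ⟨w, hw, rfl⟩ := Finset.mem_image.1 h3
        have : (W.filter (P w ∈ Q ·)).filter (P · ≠ P w) = (W.filter (P w ∈ Q ·)).erase w := by
          ext x
          simp only [Finset.mem_filter, Finset.mem_erase, ne_eq]
          constructor
          · rintro ⟨⟨h4, h5⟩, h6⟩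
            exact ⟨fun h => h6 (h ▸ rfl), h4, h5⟩
          · rintro ⟨h4, h5, h6⟩
            exact ⟨⟨h5, h6⟩, fun h => h4 (hPi h5 hw h)⟩
        rw [h1, this]
        exact Finset.card_erase_add_one (Finset.mem_filter.2 ⟨hw, hPQ w hw⟩)
      · simp [h3] at h2
    refine ih (insert u W) f' Q' ?_ ⟨?_, ?_⟩ ?_ ?_ ?_ ?_
    · rw [Finset.card_insert_of_notMem hu]
      omega
    · intro x y
      by_cases hx : x = u <;> by_cases hy : y = u <;> simp [f', hx, hy, hf.1 x y]
    · intro x hx y hy z hz hxy hxz h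
      rw [Finset.mem_insert] at hx hy hz
      rcases hx with rfl | hx
      · rw [hfu, hfu] at h
        exact hPi (hy.resolve_left hxy.ne') (hz.resolve_left hxz.ne') h
      · rcases hy with rfl | hy <;> rcases hz with rfl | hz
        · rfl
        · rw [hfw x hx, hff x hx z hz] at h
          exact (hfQ x hx z hz hxz (h ▸ hPQ x hx)).elim
        · rw [hfw x hx, hff x hx y hy] at h
          exact (hfQ x hx y hy hxy (h ▸ hPQ x hx)).elim
        · rw [hff x hx y hy, hff x hx z hz] at h
          exact hf.2 x hx y hy z hz hxy hxz h
    · intro w hw x hx hwx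
      rw [Finset.mem_insert] at hw hx
      rcases hw with rfl | hw
      · rw [hfu, hQu, Finset.mem_sdiff]
        exact fun h => h.2 (Finset.mem_image_of_mem P (hx.resolve_left hwx.ne'))
      · rw [hQw w hw]
        rcases hx with rfl | hx
        · rw [hfw w hw]
          exact Finset.notMem_erase _ _
        · rw [hff w hw x hx]
          exact fun h => hfQ w hw x hx hwx (Finset.mem_of_mem_erase h)
    · intro w hw
      rcases Finset.mem_insert.1 hw with rfl | hw
      · rw [hQu, Finset.card_sdiff_of_subset (Finset.subset_univ _),
          Finset.card_image_of_injOn hPi, Finset.card_univ]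
        omega
      · rw [hQw w hw, Finset.card_erase_of_mem (hPQ w hw), hQ w hw, Nat.add_sub_cancel]
    · intro c
      have h1 := hcount c
      have h2 := hle c
      have h3 := hpar c
      have h4 := hPc c
      by_cases h : c ∈ W.image P
      · simp only [h, if_true] at h1
        omega
      -- Parity turns "not `r + 1`" into "at most `r - 1`", which leaves room for `u`.
      · have h5 : (W.filter (c ∈ Q ·)).card ≠ r + 1 := fun h6 =>
          h (Finset.mem_image.2 (h4 h6))
        simp only [h, if_false] at h1
        omega
    · intro c
      have h1 := hcount c
      have h3 := hpar c
      by_cases h : c ∈ W.image P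
      · simp only [h, if_true] at h1
        omega
      · simp only [h, if_false] at h1
        omega

end SimpleGraph

/-! ### Greedy colouring and line graphs -/

namespace SimpleGraph

/-- Greedy extension of a partial list colouring. -/
theorem exists_greedy_extension {α C : Type*} [Fintype α] [DecidableEq α] [Fintype C]
    [DecidableEq C] (H : SimpleGraph α) [DecidableRel H.Adj] (L : α → Finset C) (s : Finset α)
    (f₀ : α → C) (hf₀ : ∀ x ∈ s, ∀ y ∈ s, H.Adj x y → f₀ x ≠ f₀ y)
    (hdeg : ∀ x ∉ s, H.degree x + (L x).card < Fintype.card C) :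
    ∃ f : α → C, (∀ x y, H.Adj x y → f x ≠ f y) ∧ ∀ x ∉ s, f x ∉ L x := by
  suffices h : ∀ t : Finset α, Disjoint s t → ∃ f : α → C,
      (∀ x ∈ s ∪ t, ∀ y ∈ s ∪ t, H.Adj x y → f x ≠ f y) ∧ ∀ x ∈ t, f x ∉ L x by
    obtain ⟨f, h1, h2⟩ := h sᶜ disjoint_compl_right
    exact ⟨f, fun x y => h1 x (by simp) y (by simp),
      fun x hx => h2 x (Finset.mem_compl.2 hx)⟩
  intro t
  induction t using Finset.induction_on with
  | empty => exact fun _ => ⟨f₀, by simpa using hf₀, by simp⟩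
  | insert a t ha ih =>
    intro hst
    rw [Finset.disjoint_insert_right] at hst
    obtain ⟨f, h1, h2⟩ := ih hst.2
    obtain ⟨c, hc⟩ : ∃ c, c ∉ (H.neighborFinset a).image f ∪ L a := by
      by_contra! h
      have h3 := Finset.card_union_le ((H.neighborFinset a).image f) (L a)
      have h4 : ((H.neighborFinset a).image f).card ≤ H.degree a := Finset.card_image_le
      rw [Finset.eq_univ_iff_forall.2 h, Finset.card_univ] at h3
      have := hdeg a hst.1
      omega
    simp only [Finset.mem_union, Finset.mem_image, mem_neighborFinset, not_or, not_exists,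
      not_and] at hc
    refine ⟨Function.update f a c, fun x hx y hy hxy => ?_, fun x hx => ?_⟩
    · rcases eq_or_ne x a with rfl | hxa
      · rw [Function.update_self, Function.update_of_ne hxy.ne']
        exact fun h => hc.1 y hxy h.symm
      · rcases eq_or_ne y a with rfl | hya
        · rw [Function.update_self, Function.update_of_ne hxa]
          exact hc.1 x hxy.symm
        · rw [Function.update_of_ne hxa, Function.update_of_ne hya]
          refine h1 x ?_ y ?_ hxy
          · simpa [hxa] using hx
          · simpa [hya] using hy
    · rcases eq_or_ne x a with rfl | hxa
      · rw [Function.update_self]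
        exact hc.2
      · rw [Function.update_of_ne hxa]
        exact h2 x (by simpa [hxa] using hx)

variable {V C : Type*}

theorem degree_lineGraph_add_two_le [Fintype V] [DecidableEq V] (G : SimpleGraph V)
    [DecidableRel G.Adj] [Fintype G.edgeSet] [DecidableRel G.lineGraph.Adj] {x y : V}
    (h : G.Adj x y) :
    G.lineGraph.degree ⟨s(x, y), h⟩ + 2 ≤ G.degree x + G.degree y := by
  have hsub : (G.lineGraph.neighborFinset ⟨s(x, y), h⟩).map (Function.Embedding.subtype _) ⊆
      (G.incidenceFinset x).erase s(x, y) ∪ (G.incidenceFinset y).erase s(x, y) := by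
    intro e he
    obtain ⟨⟨e, heG⟩, h1, rfl⟩ := Finset.mem_map.1 he
    rw [mem_neighborFinset, lineGraph_adj_iff_exists] at h1
    obtain ⟨hne, v, hv, hve⟩ := h1
    have hne' : e ≠ s(x, y) := fun h => hne (Subtype.ext h.symm)
    simp only [Sym2.mem_iff] at hv
    simp only [Function.Embedding.subtype_apply, Finset.mem_union, Finset.mem_erase, ne_eq, hne',
      not_false_eq_true, true_and, mem_incidenceFinset, incidenceSet, Set.mem_ofPred_eq]
    rcases hv with rfl | rfl
    · exact Or.inl ⟨heG, hve⟩
    · exact Or.inr ⟨heG, hve⟩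
  have h1 := (Finset.card_le_card hsub).trans (Finset.card_union_le _ _)
  rw [Finset.card_map, card_neighborFinset_eq_degree,
    Finset.card_erase_of_mem (by simp [h]), Finset.card_erase_of_mem (by simp [incidenceSet, h]),
    card_incidenceFinset_eq_degree, card_incidenceFinset_eq_degree] at h1
  have h2 : 0 < G.degree x := (G.degree_pos_iff_exists_adj x).2 ⟨y, h⟩
  have h3 : 0 < G.degree y := (G.degree_pos_iff_exists_adj y).2 ⟨x, h.symm⟩
  omega

open Classical in
/-- The symmetric function on pairs of vertices given by a function on edges. -/
noncomputable def pairColor (G : SimpleGraph V) (c₀ : C) (f : G.edgeSet → C) (x y : V) : C :=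
  if h : s(x, y) ∈ G.edgeSet then f ⟨s(x, y), h⟩ else c₀

open Classical in
theorem pairColor_comm (G : SimpleGraph V) (c₀ : C) (f : G.edgeSet → C) (x y : V) :
    G.pairColor c₀ f x y = G.pairColor c₀ f y x :=
  congrArg (fun e : Sym2 V => if h : e ∈ G.edgeSet then f ⟨e, h⟩ else c₀) Sym2.eq_swap

theorem pairColor_of_adj {G : SimpleGraph V} (c₀ : C) (f : G.edgeSet → C) {x y : V}
    (h : G.Adj x y) : G.pairColor c₀ f x y = f ⟨s(x, y), h⟩ :=
  dif_pos h

theorem pairColor_injOn {G : SimpleGraph V} (c₀ : C) {f : G.edgeSet → C}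
    (hf : ∀ e e', G.lineGraph.Adj e e' → f e ≠ f e') {x y z : V} (hy : G.Adj x y)
    (hz : G.Adj x z) (h : G.pairColor c₀ f x y = G.pairColor c₀ f x z) : y = z := by
  rw [pairColor_of_adj c₀ f hy, pairColor_of_adj c₀ f hz] at h
  by_contra hyz
  refine hf _ _ (lineGraph_adj_iff_exists.2 ⟨fun h' => ?_, x, by simp, by simp⟩) h
  exact hyz (Sym2.congr_right.1 (congrArg Subtype.val h'))

/-- The edge colouring given by a symmetric function on pairs of vertices. -/
theorem IsProperOn.lift_ne {G : SimpleGraph V} {f : V → V → C} {W : Finset V}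
    (hf : G.IsProperOn f W) {e e' : G.edgeSet} (hadj : G.lineGraph.Adj e e')
    (he : ∀ v ∈ e.1, v ∈ W) (he' : ∀ v ∈ e'.1, v ∈ W) :
    Sym2.lift ⟨f, hf.1⟩ e.1 ≠ Sym2.lift ⟨f, hf.1⟩ e'.1 := by
  obtain ⟨hne, v, hv, hv'⟩ := lineGraph_adj_iff_exists.1 hadj
  obtain ⟨e, heG⟩ := e
  obtain ⟨e', heG'⟩ := e'
  obtain ⟨y, rfl⟩ := Sym2.mem_iff_exists.1 hv
  obtain ⟨z, rfl⟩ := Sym2.mem_iff_exists.1 hv'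
  intro h
  simp only [Sym2.lift_mk] at h
  have := hf.2 v (he v hv) y (he y (by simp)) z (he' z (by simp)) heG heG' h
  subst this
  exact hne rfl

end SimpleGraph

/-! ### Colouring `d + 1` vertices with `d` colours -/

namespace SimpleGraph

variable {V C : Type*}

theorem IsProperOn.mono {G G' : SimpleGraph V} (h : G ≤ G') {f : V → V → C} {W : Finset V}
    (hf : G'.IsProperOn f W) : G.IsProperOn f W :=
  ⟨hf.1, fun x hx y hy z hz hxy hxz => hf.2 x hx y hy z hz (h hxy) (h hxz)⟩

/-- The extension starts from the empty set, where all counts are zero; evenness is the parity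
condition. -/
theorem exists_isProperOn_of_even [Fintype V] [DecidableEq V] [Fintype C] [DecidableEq C]
    [Nonempty C] (G : SimpleGraph V) (hcard : Fintype.card C + 1 = Fintype.card V)
    (heven : Even (Fintype.card V)) : ∃ f : V → V → C, G.IsProperOn f Finset.univ := by
  refine IsProperOn.exists_extension G hcard (Fintype.card V) ∅ (fun _ _ => Classical.arbitrary C)
    (fun _ => ∅) (by simp) ⟨by simp, by simp⟩ (by simp) (by simp) (by simp) (fun c => ?_)
  simp [Nat.even_iff.1 heven]

/-- The addition table of `ZMod n` is a symmetric Latin square. -/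
theorem exists_isProperOn_of_card_eq [Fintype V] [Fintype C]
    (G : SimpleGraph V) (hcard : Fintype.card C = Fintype.card V) :
    ∃ f : V → V → C, G.IsProperOn f Finset.univ := by
  rcases isEmpty_or_nonempty V with hV | hV
  · exact ⟨fun x => (hV.false x).elim, fun x => (hV.false x).elim, fun x => (hV.false x).elim⟩
  have : NeZero (Fintype.card V) := ⟨Fintype.card_ne_zero⟩
  let e : C ≃ ZMod (Fintype.card V) := Fintype.equivOfCardEq (by rw [hcard, ZMod.card])
  let i : V ≃ ZMod (Fintype.card V) := Fintype.equivOfCardEq (by rw [ZMod.card])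
  refine ⟨fun x y => e.symm (i x + i y), fun x y => congrArg e.symm (add_comm _ _), ?_⟩
  intro x _ y _ z _ _ _ h
  simpa using h

/-- `K_{2m+1}` minus `m` edges with at most `m + 1` ends altogether is `2m`-edge-colourable. -/
theorem exists_isProperOn_compl [Fintype V] [Fintype C] (m : ℕ) (hm : 0 < m)
    (hV : Fintype.card V = 2 * m + 1) (hC : Fintype.card C = 2 * m) (F : SimpleGraph V)
    [Fintype F.edgeSet] (hF : F.edgeFinset.card = m) (W : Finset V) (hW : W.card ≤ m + 1)
    (hFW : ∀ x y, F.Adj x y → x ∈ W) : ∃ f : V → V → C, Fᶜ.IsProperOn f Finset.univ := by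
  classical
  have : Nonempty C := Fintype.card_pos_iff.1 (by omega)
  let H : SimpleGraph V :=
    { Adj := fun x y => x ≠ y ∧ ¬ F.Adj x y ∧ x ∈ W ∧ y ∈ W
      symm := ⟨fun x y h => ⟨h.1.symm, fun h' => h.2.1 h'.symm, h.2.2.2, h.2.2.1⟩⟩
      loopless := ⟨fun x h => h.1 rfl⟩ }
  have hHadj : ∀ x y, H.Adj x y ↔ x ≠ y ∧ ¬ F.Adj x y ∧ x ∈ W ∧ y ∈ W := fun _ _ => Iff.rfl
  have hdeg : ∀ w ∈ W, H.degree w + F.degree w + 1 = W.card := fun w hw => by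
    rw [← card_neighborFinset_eq_degree, ← card_neighborFinset_eq_degree,
      ← Finset.card_union_of_disjoint, ← Finset.card_erase_add_one hw]
    · congr 2
      ext x
      simp only [Finset.mem_union, mem_neighborFinset, hHadj, Finset.mem_erase]
      constructor
      · rintro (h | h)
        · exact ⟨h.1.symm, h.2.2.2⟩
        · exact ⟨h.ne', hFW x w h.symm⟩
      · rintro ⟨h1, h2⟩
        by_cases h : F.Adj w x
        · exact Or.inr h
        · exact Or.inl ⟨h1.symm, h, hw, h2⟩
    · rw [Finset.disjoint_left]
      intro x h1 h2
      rw [mem_neighborFinset] at h1 h2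
      exact h1.2.1 h2
  -- There are as many darts of `F` as colours. Colour `c` is to be missing at `a c`, so that `w`
  -- misses `F.degree w` colours.
  let e : C ≃ F.Dart := Fintype.equivOfCardEq (by
    rw [dart_card_eq_twice_card_edges, hC, ← hF]
    congr!)
  let a : C → V := fun c => (e c).fst
  have haW : ∀ c, a c ∈ W := fun c => hFW _ _ (e c).adj
  have hacard : ∀ w, (Finset.univ.filter (a · = w)).card = F.degree w := fun w => by
    rw [← dart_fst_fiber_card_eq_degree]
    refine Finset.card_bij (fun c _ => e c) ?_ ?_ ?_
    · intro c hc
      simpa [a] using hc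
    · intro c _ c' _ h
      exact e.injective h
    · intro d hd
      exact ⟨e.symm d, by simpa [a] using hd, by simp⟩
  -- By `hdeg`, the adjacent edges and the colours missing at the ends exclude at most `2 * W.card -
  -- 4 ≤ 2 * m - 2` colours for an edge of `H`.
  obtain ⟨g, hg, hgL⟩ := exists_greedy_extension H.lineGraph
    (fun s => Finset.univ.filter (a · ∈ s.1) : H.edgeSet → Finset C) ∅
    (fun _ => Classical.arbitrary C) (by simp) (by
      rintro ⟨s, hs⟩ -
      induction s using Sym2.ind with | _ x y =>
      have h1 := H.degree_lineGraph_add_two_le (x := x) (y := y) hs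
      have h2 : (Finset.univ.filter (a · ∈ s(x, y))).card ≤ F.degree x + F.degree y := by
        rw [← hacard, ← hacard]
        refine (Finset.card_le_card fun c hc => ?_).trans (Finset.card_union_le _ _)
        simpa using hc
      have h3 := hdeg x hs.2.2.1
      have h4 := hdeg y hs.2.2.2
      simp only
      omega)
  let f : V → V → C := H.pairColor (Classical.arbitrary C) g
  let Q : V → Finset C := fun w =>
    Finset.univ \ (Finset.univ.filter (a · = w) ∪ (H.neighborFinset w).image (f w))
  have hQ : ∀ w c, c ∈ Q w ↔ a c ≠ w ∧ ∀ x, H.Adj w x → f w x ≠ c := fun w c => by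
    simp [Q]
  have hHF : ∀ w ∈ W, ∀ x ∈ W, Fᶜ.Adj w x → H.Adj w x := fun w hw x hx h =>
    ⟨h.1, h.2, hw, hx⟩
  have hfi : ∀ x y z, H.Adj x y → H.Adj x z → f x y = f x z → y = z := fun x y z hy hz h =>
    pairColor_injOn _ hg hy hz h
  have hfc : ∀ x y, f x y = f y x := H.pairColor_comm _ g
  have hfa : ∀ x y, H.Adj x y → a (f x y) ≠ x := fun x y h h' => by
    refine hgL ⟨s(x, y), h⟩ (by simp) (Finset.mem_filter.2 ⟨Finset.mem_univ _, ?_⟩)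
    rw [← pairColor_of_adj (Classical.arbitrary C) g h]
    change a (f x y) ∈ s(x, y)
    rw [h']
    simp
  -- `W` consists of the vertices that still need `c`, those paired by `c` within `H`, and `a c`.
  -- With `W.card ≤ m + 1` this yields both the bound and the parity for the extension.
  have hcount : ∀ c, ∃ k, (W.filter (c ∈ Q ·)).card + 2 * k + 1 = W.card := by
    intro c
    let M := W.filter fun w => ∃ x, H.Adj w x ∧ f w x = c
    have hM : Even M.card := by
      choose! p hp using fun (w : V) (hw : w ∈ M) => (Finset.mem_filter.1 hw).2
      have hpM : ∀ w ∈ M, p w ∈ M := fun w hw =>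
        Finset.mem_filter.2 ⟨(hp w hw).1.2.2.2, w, (hp w hw).1.symm, by
          rw [hfc, (hp w hw).2]⟩
      have hpp : ∀ w ∈ M, p (p w) = w := fun w hw =>
        hfi (p w) _ _ (hp _ (hpM w hw)).1 (hp w hw).1.symm (by
          rw [(hp _ (hpM w hw)).2, hfc, (hp w hw).2])
      have := Finset.sum_involution (s := M) (f := fun _ => (1 : ZMod 2)) (fun w _ => p w)
        (fun w _ => by decide) (fun w hw _ => (hp w hw).1.ne') (fun w hw => hpM w hw)
        (fun w hw => hpp w hw)
      rw [Finset.sum_const, nsmul_eq_mul, mul_one] at this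
      exact (ZMod.natCast_eq_zero_iff_even).1 this
    obtain ⟨k, hk⟩ := hM
    have haM : a c ∉ M := fun h => by
      obtain ⟨-, x, hx, hc⟩ := Finset.mem_filter.1 h
      exact hfa _ x hx (congrArg a hc)
    refine ⟨k, ?_⟩
    rw [two_mul, ← hk, add_assoc, ← Finset.card_insert_of_notMem haM,
      ← Finset.card_union_of_disjoint]
    · congr 1
      ext x
      simp only [Finset.mem_union, Finset.mem_filter, Finset.mem_insert, hQ, M]
      constructor
      · rintro (h | rfl | h)
        · exact h.1
        · exact haW c
        · exact h.1
      · intro hx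
        by_cases h1 : a c = x
        · exact Or.inr (Or.inl h1.symm)
        by_cases h2 : ∃ y, H.Adj x y ∧ f x y = c
        · exact Or.inr (Or.inr ⟨hx, h2⟩)
        · push Not at h2
          exact Or.inl ⟨hx, h1, h2⟩
    · rw [Finset.disjoint_left]
      intro x hx hx'
      obtain ⟨-, h⟩ := Finset.mem_filter.1 hx
      rw [hQ] at h
      rcases Finset.mem_insert.1 hx' with rfl | hx'
      · exact h.1 rfl
      · obtain ⟨-, y, hy, hyc⟩ := Finset.mem_filter.1 hx'
        exact h.2 y hy hyc
  refine IsProperOn.exists_extension Fᶜ (by omega) (2 * m + 1 - W.card) W f Q (by omega)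
    ⟨hfc, fun x hx y hy z hz hxy hxz =>
      hfi x y z (hHF x hx y hy hxy) (hHF x hx z hz hxz)⟩ ?_ ?_ ?_ ?_
  · intro w hw x hx h h'
    exact ((hQ w _).1 h').2 x (hHF w hw x hx h) rfl
  · intro w hw
    have h1 : ((H.neighborFinset w).image (f w)).card = H.degree w := by
      rw [Finset.card_image_of_injOn, card_neighborFinset_eq_degree]
      intro x hx y hy h
      exact hfi w x y (by simpa using hx) (by simpa using hy) h
    have h2 : Disjoint (Finset.univ.filter (a · = w)) ((H.neighborFinset w).image (f w)) := by
      rw [Finset.disjoint_left]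
      intro c h3 h4
      obtain ⟨x, hx, rfl⟩ := Finset.mem_image.1 h4
      exact hfa w x (by simpa using hx) (by simpa using h3)
    have h3 := hdeg w hw
    rw [Finset.card_sdiff_of_subset (Finset.subset_univ _), Finset.card_union_of_disjoint h2, h1,
      hacard, Finset.card_univ, hC]
    omega
  · intro c
    obtain ⟨k, hk⟩ := hcount c
    omega
  · intro c
    obtain ⟨k, hk⟩ := hcount c
    omega

-- Every non-edge has an end outside the clique, and any two such vertices form a non-edge. If that
-- end is not yet in `W`, the non-edge can be replaced by the one joining it to `s₀`; so each chosen
-- edge adds at most one vertex.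
open scoped Classical in
theorem IsSplit.exists_edges_support [Fintype V] {G : SimpleGraph V} (hG : G.IsSplit) (m : ℕ)
    (hm : 0 < m) (hcard : m ≤ Gᶜ.edgeFinset.card) :
    ∃ (F : SimpleGraph V) (W : Finset V), F ≤ Gᶜ ∧ F.edgeFinset.card = m ∧ W.card ≤ m + 1 ∧
      ∀ x y, F.Adj x y → x ∈ W := by
  obtain ⟨X, hX, hS⟩ := hG
  have hend : ∀ e ∈ Gᶜ.edgeSet, ∃ s ∉ X, s ∈ e := by
    intro e he
    induction e using Sym2.ind with | _ x y =>
    by_contra! h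
    have hx : x ∈ X := by_contra fun hx => h x hx (by simp)
    have hy : y ∈ X := by_contra fun hy => h y hy (by simp)
    exact he.2 (hX hx hy he.1)
  obtain ⟨s₀, hs₀⟩ : ∃ s, s ∉ X := by
    obtain ⟨e, he⟩ := Finset.card_pos.1 (hm.trans_le hcard)
    obtain ⟨s, hs, -⟩ := hend e (by simpa using he)
    exact ⟨s, hs⟩
  suffices h : ∀ j ≤ m, ∃ (E : Finset (Sym2 V)) (W : Finset V), E ⊆ Gᶜ.edgeFinset ∧ E.card = j ∧
      W.card ≤ j + 1 ∧ (∀ e ∈ E, ∀ v ∈ e, v ∈ W) ∧ s₀ ∈ W by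
    obtain ⟨E, W, h1, h2, h3, h4, -⟩ := h m le_rfl
    have hE : (fromEdgeSet (E : Set (Sym2 V))).edgeFinset = E := by
      ext e
      simp only [mem_edgeFinset, edgeSet_fromEdgeSet, Set.mem_sdiff, Finset.mem_coe,
        and_iff_left_iff_imp]
      exact fun he => Gᶜ.not_isDiag_of_mem_edgeSet (by simpa using h1 he)
    refine ⟨fromEdgeSet E, W, ?_, by convert h2 using 2; convert hE, h3, ?_⟩
    · intro x y h
      simpa only [mem_edgeFinset, mem_edgeSet] using h1 (x := s(x, y)) (by simpa using h.1)
    · intro x y h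
      exact h4 s(x, y) (by simpa using h.1) x (by simp)
  intro j
  induction j with
  | zero => exact fun _ => ⟨∅, {s₀}, by simp, by simp, by simp, by simp, by simp⟩
  | succ j ih =>
    intro hj
    obtain ⟨E, W, h1, h2, h3, h4, h5⟩ := ih (by omega)
    obtain ⟨e, he, heE, x, hxe, hxW⟩ : ∃ e ∈ Gᶜ.edgeFinset, e ∉ E ∧ ∃ x ∈ e, x ∈ W := by
      obtain ⟨e, he, heE⟩ : ∃ e ∈ Gᶜ.edgeFinset, e ∉ E := by
        by_contra! h
        have := Finset.card_le_card (show Gᶜ.edgeFinset ⊆ E from h)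
        omega
      obtain ⟨y, hyX, hye⟩ := hend e (by simpa using he)
      by_cases hyW : y ∈ W
      · exact ⟨e, he, heE, y, hye, hyW⟩
      have hne : y ≠ s₀ := fun h => hyW (h ▸ h5)
      refine ⟨s(y, s₀), ?_, fun h => hyW (h4 _ h y (by simp)), s₀, by simp, h5⟩
      rw [mem_edgeFinset, mem_edgeSet, compl_adj]
      exact ⟨hne, hS hyX hs₀ hne⟩
    obtain ⟨y, rfl⟩ := Sym2.mem_iff_exists.1 hxe
    refine ⟨insert s(x, y) E, insert y W, ?_, ?_, ?_, ?_, Finset.mem_insert_of_mem h5⟩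
    · exact Finset.insert_subset he h1
    · rw [Finset.card_insert_of_notMem heE, h2]
    · have := Finset.card_insert_le y W
      omega
    · intro e' he' v hv
      rcases Finset.mem_insert.1 he' with rfl | he'
      · rcases Sym2.mem_iff.1 hv with rfl | rfl
        · exact Finset.mem_insert_of_mem hxW
        · exact Finset.mem_insert_self _ _
      · exact Finset.mem_insert_of_mem (h4 e' he' v hv)

open scoped Classical in
/-- A split graph on `d + 1` vertices with at most `d * ⌊(d + 1) / 2⌋` edges is
`d`-edge-colourable. -/
theorem IsSplit.exists_isProperOn [Fintype V] [Fintype C] {G : SimpleGraph V} (hG : G.IsSplit)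
    (hpos : 0 < Fintype.card C) (hcard : Fintype.card C + 1 = Fintype.card V)
    (hle : G.edgeFinset.card ≤ Fintype.card C * (Fintype.card V / 2)) :
    ∃ f : V → V → C, G.IsProperOn f Finset.univ := by
  have : Nonempty C := Fintype.card_pos_iff.1 hpos
  rcases Nat.even_or_odd (Fintype.card V) with h | ⟨m, hm⟩
  · exact exists_isProperOn_of_even G hcard h
  have hC : Fintype.card C = 2 * m := by omega
  -- The complete graph has `(2 * m + 1) * m` edges and `G` at most `2 * m * m`.
  have hnon : m ≤ Gᶜ.edgeFinset.card := by
    have h1 : G.edgeFinset.card + Gᶜ.edgeFinset.card = (Fintype.card V).choose 2 := by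
      rw [← card_edgeFinset_top_eq_card_choose_two, ← Finset.card_union_of_disjoint]
      · congr 1
        rw [← edgeFinset_sup, ← edgeFinset_inj.2 (sup_compl_eq_top (x := G))]
      · exact disjoint_edgeFinset.2 disjoint_compl_right
    rw [hm, Nat.choose_two_right] at h1
    have h2 : (2 * m + 1) * (2 * m + 1 - 1) / 2 = (2 * m + 1) * m := by
      rw [Nat.add_sub_cancel, show (2 * m + 1) * (2 * m) = (2 * m + 1) * m * 2 by ring,
        Nat.mul_div_cancel _ two_pos]
    rw [h2] at h1
    rw [hm, hC, show (2 * m + 1) / 2 = m by omega] at hle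
    nlinarith
  obtain ⟨F, W, h1, h2, h3, h4⟩ := hG.exists_edges_support m (by omega) hnon
  obtain ⟨f, hf⟩ := exists_isProperOn_compl (C := C) m (by omega) hm hC F h2 W h3 h4
  exact ⟨f, hf.mono (le_compl_comm.1 h1)⟩

end SimpleGraph

/-! ### Overfullness and reduction to a closed neighbourhood -/

namespace SimpleGraph

variable {V C : Type*}

/-- Each colour class is a matching, hence has at most half as many edges as there are vertices. -/
theorem EdgeColorable.card_edgeFinset_le [Fintype V] {G : SimpleGraph V} [Fintype G.edgeSet]
    {k : ℕ} (h : G.EdgeColorable k) : G.edgeFinset.card ≤ k * (Fintype.card V / 2) := by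
  classical
  obtain ⟨c⟩ := h
  have hclass : ∀ i, (Finset.univ.filter (c · = i)).card ≤ Fintype.card V / 2 := by
    intro i
    rw [Nat.le_div_iff_mul_le two_pos]
    have := Finset.card_mul_le_card_mul (s := Finset.univ.filter (c · = i))
      (t := (Finset.univ : Finset V)) (m := 2) (n := 1) (fun e v => v ∈ e.1)
      (fun e _ => by
        rw [← Sym2.card_toFinset_of_not_isDiag e.1 (G.not_isDiag_of_mem_edgeSet e.2)]
        refine Finset.card_le_card fun v hv => ?_
        simpa [Finset.bipartiteAbove] using hv)
      (fun v _ => by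
        rw [Finset.card_le_one]
        intro e he e' he'
        simp only [Finset.bipartiteBelow, Finset.mem_filter, Finset.mem_univ, true_and] at he he'
        by_contra hne
        exact c.valid (lineGraph_adj_iff_exists.2 ⟨hne, v, he.2, he'.2⟩) (he.1.trans he'.1.symm))
    simpa using this
  rw [edgeFinset_card, ← Finset.card_univ,
    Finset.card_eq_sum_card_fiberwise (f := c) (t := Finset.univ) (by simp)]
  refine (Finset.sum_le_card_nsmul _ _ _ fun i _ => hclass i).trans ?_
  simp

theorem EdgeColorable.coe {G : SimpleGraph V} {k : ℕ} (h : G.EdgeColorable k) (H : G.Subgraph) :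
    H.coe.EdgeColorable k :=
  h.of_hom (Copy.toLineGraphEmbedding H.coeCopy).toHom

theorem IsProperOn.comp_injective {D : Type*} {G : SimpleGraph V} {f : V → V → C} {W : Finset V}
    (hf : G.IsProperOn f W) {g : C → D} (hg : Function.Injective g) :
    G.IsProperOn (fun x y => g (f x y)) W :=
  ⟨fun x y => congrArg g (hf.1 x y), fun x hx y hy z hz hxy hxz h =>
    hf.2 x hx y hy z hz hxy hxz (hg h)⟩

/-- Vertices of degree at most one can be ignored in edge colouring. -/
theorem edgeColorable_of_induce [Fintype V] (G : SimpleGraph V) [DecidableRel G.Adj] (s : Set V)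
    (hs : ∀ v ∉ s, G.degree v ≤ 1) {k : ℕ} (hk : 0 < k) (hdeg : G.maxDegree ≤ k)
    (hf : ∃ f : s → s → Fin k, ∀ W, (G.induce s).IsProperOn f W) : G.EdgeColorable k := by
  classical
  obtain ⟨f, hf⟩ := hf
  let F : V → V → Fin k := fun x y =>
    if h : x ∈ s ∧ y ∈ s then f ⟨x, h.1⟩ ⟨y, h.2⟩ else ⟨0, hk⟩
  have hF : G.IsProperOn F s.toFinset := by
    refine ⟨fun x y => ?_, fun x hx y hy z hz hxy hxz h => ?_⟩
    · by_cases h : x ∈ s ∧ y ∈ s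
      · simp only [F, h, and_self, dif_pos, (hf ∅).1 ⟨x, h.1⟩]
      · simp only [F, dif_neg h, dif_neg (fun h' => h (And.symm h'))]
    · rw [Set.mem_toFinset] at hx hy hz
      simp only [F, hx, hy, hz, and_self, dif_pos] at h
      exact congrArg Subtype.val ((hf Finset.univ).2 ⟨x, hx⟩ (Finset.mem_univ _) ⟨y, hy⟩
        (Finset.mem_univ _) ⟨z, hz⟩ (Finset.mem_univ _) hxy hxz h)
  -- An edge not inside `s` has an end of degree at most one, so at most `k - 1` edges meet it.
  obtain ⟨g, hg, -⟩ := exists_greedy_extension G.lineGraph (fun _ => (∅ : Finset (Fin k)))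
    (Finset.univ.filter fun e => ∀ v ∈ e.1, v ∈ s.toFinset)
    (fun e => Sym2.lift ⟨F, hF.1⟩ e.1)
    (fun e he e' he' h => hF.lift_ne h (Finset.mem_filter.1 he).2 (Finset.mem_filter.1 he').2)
    (by
      rintro ⟨e, he⟩ hes
      induction e using Sym2.ind with | _ x y =>
      have h1 := G.degree_lineGraph_add_two_le (x := x) (y := y) he
      have h2 := G.degree_le_maxDegree x
      have h3 := G.degree_le_maxDegree y
      have h4 : x ∉ s ∨ y ∉ s := by
        by_contra! h
        refine hes (Finset.mem_filter.2 ⟨Finset.mem_univ _, fun v hv => ?_⟩)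
        rcases Sym2.mem_iff.1 hv with rfl | rfl
        · simpa using h.1
        · simpa using h.2
      rw [Finset.card_empty, Fintype.card_fin]
      rcases h4 with h4 | h4
      · have := hs x h4
        omega
      · have := hs y h4
        omega)
  exact ⟨Coloring.mk g fun {e e'} h => hg e e' h⟩

theorem IsSplit.induce {G : SimpleGraph V} (hG : G.IsSplit) (s : Set V) :
    (G.induce s).IsSplit := by
  obtain ⟨X, hX, hS⟩ := hG
  exact ⟨Subtype.val ⁻¹' X, fun x hx y hy h => hX hx hy (fun h' => h (Subtype.ext h')),
    fun x hx y hy h => hS hx hy (fun h' => h (Subtype.ext h'))⟩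

open scoped Classical in
/-- A closed neighbourhood of a vertex of maximum degree that induces an overfull graph makes the
graph subgraph-overfull. -/
theorem isSubgraphOverfull_of_lt [Fintype V] {G : SimpleGraph V} {u : V}
    (hu : G.degree u = G.maxDegree) {s : Set V} (hs : ∀ v, v ∈ s ↔ v = u ∨ G.Adj u v)
    (hcard : Fintype.card s = G.degree u + 1)
    (hlt : G.maxDegree * (Fintype.card s / 2) < (G.induce s).edgeFinset.card) :
    G.IsSubgraphOverfull := by
  have hmax : (G.induce s).maxDegree = G.maxDegree := by
    apply le_antisymm
    · refine maxDegree_le_of_forall_degree_le _ _ fun v => ?_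
      have := (G.induce s).degree_lt_card_verts v
      omega
    · rw [← hu]
      have hus : u ∈ s := (hs u).2 (Or.inl rfl)
      refine le_trans (le_of_eq ?_) ((G.induce s).degree_le_maxDegree ⟨u, hus⟩)
      rw [← card_neighborFinset_eq_degree, ← card_neighborFinset_eq_degree,
        ← Finset.card_map (Function.Embedding.subtype _)]
      congr 1
      ext v
      simp only [mem_neighborFinset, Finset.mem_map, Function.Embedding.subtype_apply,
        comap_adj, Subtype.exists, exists_and_right, exists_eq_right]
      exact ⟨fun h => ⟨(hs v).2 (Or.inr h), h⟩, fun ⟨_, h⟩ => h⟩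
  obtain ⟨i⟩ : Nonempty (((⊤ : G.Subgraph).induce s).coe ≃g G.induce s) :=
    ⟨by rw [induce_eq_coe_induce_top]; exact Iso.refl⟩
  have hmax' := i.maxDegree_eq.trans hmax
  refine ⟨(⊤ : G.Subgraph).induce s, by convert hmax', ?_⟩
  rw [← hmax, ← i.maxDegree_eq, ← i.card_edgeFinset_eq, ← Fintype.card_congr i.toEquiv] at hlt
  unfold IsOverfull
  convert hlt

end SimpleGraph

/-! ### The equivalence -/

open SimpleGraph in
theorem mainTheorem7 {V : Type*} [Fintype V] (G : SimpleGraph V) [DecidableRel G.Adj]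
    (hconn : G.Connected) (hsplit : G.IsSplit) (hσ : G.stretchIndex = 2)
    (hΔ : (Fintype.card V : ℚ) / 3 < (G.maxDegree : ℚ)) :
    G.IsClassOne ↔ ¬ G.IsSubgraphOverfull := by
  classical
  obtain rfl : ‹DecidableRel G.Adj› = fun a b => Classical.propDecidable (G.Adj a b) :=
    Subsingleton.elim _ _
  constructor
  · rintro h ⟨H, h1, h2⟩
    have h3 := (EdgeColorable.coe h H).card_edgeFinset_le
    rw [← h1] at h3
    exact absurd h3 (not_le.2 h2)
  intro hno
  -- The infimum of the empty set is `0`, so the value `2` is attained.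
  have hadm : G.IsAdmissible 2 := by
    have := Nat.sInf_mem (Nat.nonempty_of_pos_sInf (s := {t : ℕ | G.IsAdmissible t})
      (show 0 < G.stretchIndex by omega))
    rw [stretchIndex] at hσ
    rwa [hσ] at this
  obtain ⟨T, hT⟩ := hadm
  have := hconn.nonempty
  obtain ⟨u, hu⟩ := hT.exists_adj_of_isSplit hsplit
  have hpos : 0 < G.maxDegree := by
    have : (0 : ℚ) < G.maxDegree := lt_of_le_of_lt (by positivity) hΔ
    exact_mod_cast this
  obtain ⟨s, hs⟩ : ∃ s : Set V, ∀ v, v ∈ s ↔ v = u ∨ G.Adj u v :=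
    ⟨{v | v = u ∨ G.Adj u v}, fun _ => Iff.rfl⟩
  have hcard : Fintype.card s = G.degree u + 1 := by
    rw [← Set.toFinset_card, ← card_neighborFinset_eq_degree,
      ← Finset.card_insert_of_notMem (G.notMem_neighborFinset_self u)]
    congr 1
    ext v
    simp [hs]
  refine edgeColorable_of_induce G s (fun v hv => ?_) hpos le_rfl ?_
  · have h1 := (hu v).resolve_left fun h => hv <| (hs v).2 (Or.inl h)
    have h2 := h1.resolve_left fun h => hv <| (hs v).2 (Or.inr h)
    rw [← card_neighborFinset_eq_degree, Finset.card_le_one]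
    intro a ha b hb
    exact h2 (by simpa using ha) (by simpa using hb)
  suffices h : ∃ f : s → s → Fin G.maxDegree, (G.induce s).IsProperOn f Finset.univ by
    obtain ⟨f, hf⟩ := h
    exact ⟨f, fun W => ⟨hf.1, fun x _ y _ z _ => hf.2 x (by simp) y (by simp) z (by simp)⟩⟩
  rcases (G.degree_le_maxDegree u).lt_or_eq with hlt | heq
  · obtain ⟨f, hf⟩ := exists_isProperOn_of_card_eq (C := Fin (Fintype.card s)) (G.induce s)
      (Fintype.card_fin _)
    exact ⟨_, hf.comp_injective (Fin.castLE_injective (show Fintype.card s ≤ G.maxDegree by omega))⟩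
  · refine (hsplit.induce s).exists_isProperOn (by simpa using hpos) (by rw [Fintype.card_fin]; omega) ?_
    by_contra! h
    rw [Fintype.card_fin] at h
    exact hno (isSubgraphOverfull_of_lt heq hs (by convert hcard) (by convert h; rfl))
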